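/- Let $d\ge 1$ and $\alpha>\tfrac12$, and let $\mathbb T^d=(\mathbb R/2\pi\mathbb Z)^d$ with Lebesgue measure. For $f\in L_2(\mathbb T^d)$ put $c_k(f)=(2\pi)^{-d}\int_{\mathbb T^d}f(x)e^{-ik\cdot x}\,dx$ $(k\in\mathbb Z^d)$. The space $H^\alpha_{\rm mix}(\mathbb T^d)$ consists of all $f\in L_2(\mathbb T^d)$ with $\sum_{k\in\mathbb Z^d}|c_k(f)|^2\prod_{j=1}^d(1+|k_j|^2)^\alpha<\infty$, and it is normed by $$\|f\|_{H^\alpha_{\rm mix}(\mathbb T^d)}=\Big(\sum_{\ell\in\mathbb N_0^d}2^{2\alpha|\ell|_1}\|\delta_\ell(f)\|_2^2\Big)^{1/2},\qquad \delta_\ell(f)=\sum_{k\in P_{\ell_1}\times\cdots\times P_{\ell_d}}c_k(f)e^{ik\cdot x},$$ where $P_0=\{0\}$ and $P_j=\{n\in\mathbb Z:2^{j-1}\le|n|<2^j\}$ for $j\ge1$ (an equivalent norm is $(\sum_k|c_k(f)|^2\prod_j(1+|k_j|^2)^\alpha)^{1/2}$). For $n\in\mathbb N$ let $$I_nf(t)=\frac1{2n+1}\sum_{\ell=0}^{2n}f(t^n_\ell)\,D_n(t-t^n_\ell),\qquad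 t^n_\ell=\frac{2\pi\ell}{2n+1},\qquad D_n(t)=\sum_{|k|\le n}e^{ikt},$$ let $\eta_0=I_1$ and $\eta_j=I_{2^j}-I_{2^{j-1}}$ for $j\ge1$, and for $k\in\mathbb N_0^d$ let $q_k=\eta_{k_1}\otimes\cdots\otimes\eta_{k_d}$, where $\eta_{k_j}$ acts on the $j$-th variable. For $m\in\mathbb N$ let $$Q_{\Delta(\alpha m)}=\sum_{k\in\Delta(\alpha m)}q_k,\qquad \Delta(\alpha m)=\{k\in\mathbb N_0^d:\alpha|k|_1\le\alpha m\}=\{k\in\mathbb N_0^d:|k|_1\le m\}.$$ Then every $f\in H^\alpha_{\rm mix}(\mathbb T^d)$ has a continuous representative (to which $Q_{\Delta(\alpha m)}$ is applied), and there is a constant $C=C(\alpha,d)>0$ such that $$\|f-Q_{\Delta(\alpha m)}f\|_\infty\le C\,2^{-m(\alpha-\frac12)}\,m^{\frac{d-1}2}\,\|f\|_{H^\alpha_{\rm mix}(\mathbb T^d)}$$ holds for all $f\in H^\alpha_{\rm mix}(\mathbb T^d)$ and all $m\in\mathbb N=\{1,2,\dots\}$. -/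

import Mathlib

open MeasureTheory
open scoped ENNReal

noncomputable section

namespace SmolyakTrig

/-- The period `2π` is positive (used for the measure of the circle). -/
instance twoPiPos : Fact (0 < 2 * Real.pi) := ⟨Real.two_pi_pos⟩

/-- The circle `ℝ / 2πℤ`. -/
abbrev Circ : Type := AddCircle (2 * Real.pi)

/-- The `d`-dimensional torus `(ℝ / 2πℤ)^d`; its `volume` is Lebesgue measure, of total mass
`(2π)^d`. -/
abbrev Torus (d : ℕ) : Type := Fin d → Circ

/-- The exponential `x ↦ e^{i k·x}` on the torus. -/
def expo {d : ℕ} (k : Fin d → ℤ) (x : Torus d) : ℂ := ∏ j, fourier (k j) (x j)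

/-- The Fourier coefficient `c_k(f) = (2π)^{-d} ∫ f(x) e^{-i k·x} dx`. -/
def coeff {d : ℕ} (f : Torus d → ℂ) (k : Fin d → ℤ) : ℂ :=
  (((2 * Real.pi) ^ d : ℝ) : ℂ)⁻¹ * ∫ x : Torus d, f x * expo (-k) x

/-- Membership of `f ∈ L₂` in the periodic Sobolev space of dominating mixed smoothness `α`:
`∑_k |c_k(f)|² ∏_j (1 + |k_j|²)^α < ∞`. -/
def MemHmix {d : ℕ} (α : ℝ) (f : Lp ℂ 2 (volume : Measure (Torus d))) : Prop :=
  Summable fun k : Fin d → ℤ => ‖coeff f k‖ ^ 2 * ∏ j, (1 + ((k j : ℤ) : ℝ) ^ 2) ^ α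

/-- The dyadic blocks `P_0 = {0}` and `P_j = {n : 2^{j-1} ≤ |n| < 2^j}` for `j ≥ 1`. -/
def dyadicBlock : ℕ → Finset ℤ
  | 0 => {0}
  | j + 1 => (Finset.Icc (-2 ^ (j + 1)) (2 ^ (j + 1))).filter
      fun n => 2 ^ j ≤ |n| ∧ |n| < 2 ^ (j + 1)

/-- `δ_ℓ(f)`, the part of the Fourier series of `f` with frequencies in `P_{ℓ_1} × ⋯ × P_{ℓ_d}`. -/
def blockPart {d : ℕ} (f : Torus d → ℂ) (l : Fin d → ℕ) (x : Torus d) : ℂ :=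
  ∑ k ∈ Fintype.piFinset fun j => dyadicBlock (l j), coeff f k * expo k x

/-- The norm `(∑_{ℓ ∈ ℕ₀^d} 2^{2α|ℓ|₁} ‖δ_ℓ(f)‖₂²)^{1/2}` of mixed smoothness `α`. -/
def hmixNorm {d : ℕ} (α : ℝ) (f : Torus d → ℂ) : ℝ≥0∞ :=
  (∑' l : Fin d → ℕ, ENNReal.ofReal ((2 : ℝ) ^ (2 * α * ((∑ j, l j : ℕ) : ℝ))) *
    eLpNorm (blockPart f l) 2 volume ^ 2) ^ (1 / 2 : ℝ)

/-- The Dirichlet kernel `D_m(t) = ∑_{|k| ≤ m} e^{ikt}`. -/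
def dirichletKernel (m : ℕ) (t : Circ) : ℂ :=
  ∑ k ∈ Finset.Icc (-(m : ℤ)) (m : ℤ), fourier k t

/-- The equidistant nodes `t^m_ℓ = 2πℓ / (2m+1)`. -/
def node (m l : ℕ) : Circ := ((2 * Real.pi * l / (2 * m + 1) : ℝ) : Circ)

/-- Univariate trigonometric interpolation
`I_m f(t) = (2m+1)^{-1} ∑_{ℓ=0}^{2m} f(t^m_ℓ) D_m(t - t^m_ℓ)`. -/
def trigInterp (m : ℕ) : Module.End ℂ (Circ → ℂ) where
  toFun f t := (1 / (2 * (m : ℂ) + 1)) *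
    ∑ l ∈ Finset.range (2 * m + 1), f (node m l) * dirichletKernel m (t - node m l)
  map_add' f g := by
    funext t
    simp only [Pi.add_apply, add_mul, Finset.sum_add_distrib, mul_add]
  map_smul' c f := by
    funext t
    simp only [Pi.smul_apply, smul_eq_mul, RingHom.id_apply, mul_assoc, ← Finset.mul_sum]
    ring

/-- `η_0 = I_1` and `η_m = I_{2^m} - I_{2^{m-1}}` for `m ≥ 1`. -/
def eta : ℕ → Module.End ℂ (Circ → ℂ)
  | 0 => trigInterp 1
  | m + 1 => trigInterp (2 ^ (m + 1)) - trigInterp (2 ^ m)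

/-- The univariate operator `A` acting on the `i`-th variable of a function on the torus, the other
variables being kept fixed. -/
def onVar {d : ℕ} (i : Fin d) (A : Module.End ℂ (Circ → ℂ)) : Module.End ℂ (Torus d → ℂ) where
  toFun F x := A (fun t => F (Function.update x i t)) (x i)
  map_add' F G := by
    funext x
    exact congrFun (A.map_add (fun t => F (Function.update x i t))
      (fun t => G (Function.update x i t))) (x i)
  map_smul' c F := by
    funext x
    exact congrFun (A.map_smul c (fun t => F (Function.update x i t))) (x i)

/-- The tensor product operator `q_k = η_{k_1} ⊗ ⋯ ⊗ η_{k_d}`: the operators `η_{k_j}` applied to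
the `j`-th variable, for every `j`. -/
def q {d : ℕ} (k : Fin d → ℕ) : Module.End ℂ (Torus d → ℂ) :=
  ((List.finRange d).map fun j => onVar j (eta (k j))).prod

/-- The sampling operator `Q_Δ = ∑_{k ∈ Δ} q_k` of a finite index set `Δ`. -/
def samplingOp {d : ℕ} (Δ : Finset (Fin d → ℕ)) : Module.End ℂ (Torus d → ℂ) :=
  ∑ k ∈ Δ, q k

/-- The Smolyak index set `Δ(α; ξ) = {k ∈ ℕ₀^d : α |k|₁ ≤ ξ}`, for `α > 0`. -/
def smolyakIndex (d : ℕ) (α ξ : ℝ) : Finset (Fin d → ℕ) :=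
  (Fintype.piFinset fun _ => Finset.range (⌊ξ / α⌋₊ + 1)).filter
    fun k => α * ((∑ j, k j : ℕ) : ℝ) ≤ ξ

/-- The bounding box in the definition of `Δ(α; ξ)` loses nothing. -/
theorem mem_smolyakIndex {d : ℕ} {α : ℝ} (hα : 0 < α) (ξ : ℝ) (k : Fin d → ℕ) :
    k ∈ smolyakIndex d α ξ ↔ α * ((∑ j, k j : ℕ) : ℝ) ≤ ξ := by
  simp only [smolyakIndex, Finset.mem_filter, Fintype.mem_piFinset, Finset.mem_range,
    and_iff_right_iff_imp]
  intro h i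
  have h1 : k i ≤ ∑ j, k j := Finset.single_le_sum (fun _ _ => Nat.zero_le _) (Finset.mem_univ i)
  refine Nat.lt_succ_of_le (h1.trans (Nat.le_floor ?_))
  rw [le_div_iff₀ hα, mul_comm]
  exact h

/-- `Δ(α; α m) = {k ∈ ℕ₀^d : |k|₁ ≤ m}`. -/
theorem mem_smolyakIndex_mul {d : ℕ} {α : ℝ} (hα : 0 < α) (m : ℕ) (k : Fin d → ℕ) :
    k ∈ smolyakIndex d α (α * m) ↔ ∑ j, k j ≤ m := by
  rw [mem_smolyakIndex hα, mul_le_mul_iff_right₀ hα, Nat.cast_le]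

end SmolyakTrig

end

/-! For `α > 1/2` the Fourier series of `f` converges absolutely, and sampling operators are
continuous for pointwise convergence, so the error at a point is at most `∑ |c_n| |e_n - Q e_n|`,
summed over exponentials `e_n`.

Interpolation sends an exponential to an alias of itself or to 0, so `|q_k e_n| ≤ 2^d`
(`norm_q_expo_le`). If `n` lies in block `l`, then `q_k e_n = 0` unless `k ≤ l`, and the sum over
all `k ≤ l` telescopes to `e_n`. The error on `e_n` is thus the sum over `k ≤ l` with `|k|₁ > m`, of
which there are at most `(|l|₁ - m)₊^d` (`card_Iic_sdiff_smolyakIndex_le`).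

Cauchy-Schwarz within each block and then over blocks (`tsum_coeff_mul_le`) leaves the square root
of `∑_l (|l|₁ - m)₊^{2d} 2^{(1-2α)|l|₁}`. At most `(s+1)^{d-1}` indices have length `s`;
substituting `s = t + m` extracts `m^{d-1} 2^{(1-2α)m}` times a convergent series in `t`
(`tsum_tail_le`). -/

namespace SmolyakTrig

/-! ### Univariate interpolation of exponentials -/

section Interpolation

theorem fourier_sub_point (k : ℤ) (t s : Circ) :
    fourier k (t - s) = fourier k t * fourier (-k) s := by
  rw [fourier_neg]
  simp only [fourier_apply, sub_eq_add_neg, smul_add, smul_neg, AddCircle.toCircle_add,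
    AddCircle.toCircle_neg, Circle.coe_mul, Circle.coe_inv_eq_conj]

theorem fourier_node (n : ℤ) (m l : ℕ) :
    fourier n (node m l) = Complex.exp (2 * Real.pi * Complex.I * (n / (2 * m + 1))) ^ l := by
  rw [node, fourier_coe_apply, ← Complex.exp_nat_mul]
  congr 1
  have h1 : (Real.pi : ℂ) ≠ 0 := by exact_mod_cast Real.pi_ne_zero
  have h2 : (2 * m + 1 : ℂ) ≠ 0 := by exact_mod_cast (Nat.succ_ne_zero (2 * m))
  push_cast
  field_simp

/-- A geometric sum over powers of a `(2m+1)`-th root of unity. -/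
theorem sum_fourier_node (n : ℤ) (m : ℕ) :
    ∑ l ∈ Finset.range (2 * m + 1), fourier n (node m l) =
      if (2 * m + 1 : ℤ) ∣ n then (2 * m + 1 : ℂ) else 0 := by
  have h2 : (2 * m + 1 : ℂ) ≠ 0 := by exact_mod_cast (Nat.succ_ne_zero (2 * m))
  simp only [fourier_node]
  split_ifs with h
  · obtain ⟨c, rfl⟩ := h
    have : Complex.exp (2 * Real.pi * Complex.I * (((2 * m + 1 : ℤ) * c : ℤ) / (2 * m + 1))) = 1 :=
      Complex.exp_eq_one_iff.2 ⟨c, by push_cast; field_simp⟩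
    simp only [this, one_pow, Finset.sum_const, Finset.card_range, nsmul_eq_mul, mul_one]
    push_cast
    rfl
  · have hz : Complex.exp (2 * Real.pi * Complex.I * (n / (2 * m + 1))) ≠ 1 := by
      intro h1
      obtain ⟨c, hc⟩ := Complex.exp_eq_one_iff.1 h1
      have h3 : (n : ℂ) / (2 * m + 1) = c := by
        have := Complex.two_pi_I_ne_zero
        rw [mul_comm] at hc
        exact mul_right_cancel₀ this hc
      rw [div_eq_iff h2] at h3
      exact h ⟨c, by rw [mul_comm]; exact_mod_cast h3⟩
    rw [geom_sum_eq hz, ← Complex.exp_nat_mul,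
      Complex.exp_eq_one_iff.2 ⟨n, by push_cast; field_simp⟩, sub_self, zero_div]

/-- Interpolation of an exponential: aliasing to the frequencies `|k| ≤ m` that are congruent to
`n` modulo `2m + 1`. -/
theorem trigInterp_fourier (m : ℕ) (n : ℤ) (t : Circ) :
    trigInterp m (fun s => fourier n s) t =
      ∑ k ∈ (Finset.Icc (-(m : ℤ)) m).filter (fun k => (2 * m + 1 : ℤ) ∣ n - k), fourier k t := by
  have h2 : (2 * m + 1 : ℂ) ≠ 0 := by exact_mod_cast (Nat.succ_ne_zero (2 * m))
  change (1 / (2 * (m : ℂ) + 1)) * ∑ l ∈ Finset.range (2 * m + 1),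
    fourier n (node m l) * dirichletKernel m (t - node m l) = _
  simp only [dirichletKernel, Finset.mul_sum, fourier_sub_point]
  rw [Finset.sum_comm, Finset.sum_filter]
  refine Finset.sum_congr rfl fun k _ => ?_
  have := sum_fourier_node (n - k) m
  rw [show ∑ l ∈ Finset.range (2 * m + 1), 1 / (2 * (m : ℂ) + 1) *
      (fourier n (node m l) * (fourier k t * fourier (-k) (node m l))) =
      1 / (2 * (m : ℂ) + 1) * fourier k t *
        ∑ l ∈ Finset.range (2 * m + 1), fourier (n - k) (node m l) from ?_, this]
  · split_ifs
    · field_simp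
    · simp
  · rw [Finset.mul_sum]
    refine Finset.sum_congr rfl fun l _ => ?_
    rw [sub_eq_add_neg, fourier_add]
    ring

/-- Two frequencies in `[-m, m]` differ by less than `2m + 1`. -/
theorem card_alias_le_one (m : ℕ) (n : ℤ) :
    ((Finset.Icc (-(m : ℤ)) m).filter (fun k => (2 * m + 1 : ℤ) ∣ n - k)).card ≤ 1 := by
  refine Finset.card_le_one.2 fun a ha b hb => ?_
  simp only [Finset.mem_filter, Finset.mem_Icc] at ha hb
  have h := dvd_sub hb.2 ha.2
  rw [sub_sub_sub_cancel_left] at h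
  have := Int.eq_zero_of_abs_lt_dvd h (by rw [abs_lt]; constructor <;> linarith)
  linarith

theorem norm_fourier_apply (n : ℤ) (t : Circ) : ‖(fourier n t : ℂ)‖ = 1 := by
  rw [fourier_apply, Circle.norm_coe]

theorem norm_trigInterp_fourier_le (m : ℕ) (n : ℤ) (t : Circ) :
    ‖trigInterp m (fun s => fourier n s) t‖ ≤ 1 := by
  rw [trigInterp_fourier]
  refine (norm_sum_le _ _).trans ?_
  simp only [norm_fourier_apply, Finset.sum_const, nsmul_eq_mul, mul_one]
  exact_mod_cast card_alias_le_one m n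

theorem trigInterp_fourier_of_le (m : ℕ) (n : ℤ) (h : |n| ≤ m) :
    trigInterp m (fun s => fourier n s) = fun s => fourier n s := by
  funext t
  rw [trigInterp_fourier]
  rw [abs_le] at h
  have hn : n ∈ (Finset.Icc (-(m : ℤ)) m).filter (fun k => (2 * m + 1 : ℤ) ∣ n - k) := by
    simp [h.1, h.2]
  obtain ⟨a, ha⟩ := Finset.card_eq_one.1
    (le_antisymm (card_alias_le_one m n) (Finset.card_pos.2 ⟨n, hn⟩))
  rw [ha] at hn ⊢
  rw [Finset.sum_singleton, ← Finset.mem_singleton.1 hn]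

/-- The bound is uniform in `k`: on single exponentials the growing Lebesgue constants of
interpolation play no role. -/
theorem norm_eta_fourier_le (k : ℕ) (n : ℤ) (t : Circ) :
    ‖eta k (fun s => fourier n s) t‖ ≤ 2 := by
  cases k with
  | zero => exact (norm_trigInterp_fourier_le 1 n t).trans one_le_two
  | succ k =>
    refine (norm_sub_le _ _).trans ?_
    linarith [norm_trigInterp_fourier_le (2 ^ (k + 1)) n t, norm_trigInterp_fourier_le (2 ^ k) n t]

theorem sum_range_eta (l : ℕ) :
    ∑ k ∈ Finset.range (l + 1), eta k = trigInterp (2 ^ l) := by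
  induction l with
  | zero => simp [eta]
  | succ l ih => rw [Finset.sum_range_succ, ih]; simp [eta]

theorem sum_eta_fourier (l : ℕ) (n : ℤ) (hn : |n| ≤ 2 ^ l) (t : Circ) :
    ∑ k ∈ Finset.range (l + 1), eta k (fun s => fourier n s) t = fourier n t := by
  rw [← Finset.sum_apply, ← LinearMap.sum_apply, sum_range_eta, trigInterp_fourier_of_le]
  exact_mod_cast hn

theorem eta_fourier_eq_zero {k l : ℕ} (hkl : l < k) (n : ℤ) (hn : |n| ≤ 2 ^ l) :
    eta k (fun s => fourier n s) = 0 := by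
  obtain ⟨k, rfl⟩ : ∃ j, k = j + 1 := ⟨k - 1, by omega⟩
  have h1 : (2 : ℤ) ^ l ≤ 2 ^ k := pow_le_pow_right₀ (by norm_num) (by omega)
  have h2 : (2 : ℤ) ^ l ≤ 2 ^ (k + 1) := pow_le_pow_right₀ (by norm_num) (by omega)
  rw [eta, LinearMap.sub_apply, trigInterp_fourier_of_le _ _ (by exact_mod_cast hn.trans h2),
    trigInterp_fourier_of_le _ _ (by exact_mod_cast hn.trans h1), sub_self]

/-- The topology is that of pointwise convergence; each value of the interpolant depends on finitely
many samples. -/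
theorem continuous_trigInterp (m : ℕ) : Continuous (trigInterp m) := by
  refine continuous_pi fun t => ?_
  change Continuous fun f : Circ → ℂ => (1 / (2 * (m : ℂ) + 1)) *
    ∑ l ∈ Finset.range (2 * m + 1), f (node m l) * dirichletKernel m (t - node m l)
  fun_prop

theorem continuous_eta (k : ℕ) : Continuous (eta k) := by
  cases k with
  | zero => exact continuous_trigInterp 1
  | succ k => exact (continuous_trigInterp _).sub (continuous_trigInterp _)

end Interpolation

/-! ### Tensor products and the error on one exponential -/

section TensorProduct

variable {d : ℕ}

theorem continuous_onVar (i : Fin d) {A : Module.End ℂ (Circ → ℂ)} (hA : Continuous A) :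
    Continuous (onVar i A) := by
  refine continuous_pi fun x => ?_
  exact (continuous_apply (x i)).comp (hA.comp (continuous_pi fun t =>
    continuous_apply (Function.update x i t)))

theorem continuous_q (k : Fin d → ℕ) : Continuous (q k) := by
  have : ∀ L : List (Fin d), Continuous ((L.map fun j => onVar j (eta (k j))).prod) := by
    intro L
    induction L with
    | nil => exact continuous_id
    | cons a L ih =>
      rw [List.map_cons, List.prod_cons]
      exact (continuous_onVar a (continuous_eta _)).comp ih
  exact this _

/-- Sampling operators are continuous for pointwise convergence. -/
theorem continuous_samplingOp (Δ : Finset (Fin d → ℕ)) : Continuous (samplingOp Δ) := by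
  have : (samplingOp Δ : (Torus d → ℂ) → Torus d → ℂ) = fun f => ∑ k ∈ Δ, q k f := by
    funext f
    rw [samplingOp, LinearMap.sum_apply]
  rw [this]
  exact continuous_finsetSum _ fun k _ => continuous_q k

theorem onVar_prod (i : Fin d) (A : Module.End ℂ (Circ → ℂ)) (F : Fin d → Circ → ℂ) :
    onVar i A (fun x => ∏ j, F j (x j)) = fun x => ∏ j, Function.update F i (A (F i)) j (x j) := by
  funext x
  change A (fun t => ∏ j, F j (Function.update x i t j)) (x i) = _
  have h : (fun t => ∏ j, F j (Function.update x i t j)) =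
      (∏ j ∈ Finset.univ.erase i, F j (x j)) • F i := by
    funext t
    rw [← Finset.mul_prod_erase _ _ (Finset.mem_univ i), Function.update_self, Pi.smul_apply,
      smul_eq_mul, mul_comm]
    congr 1
    refine Finset.prod_congr rfl fun j hj => ?_
    rw [Function.update_of_ne (Finset.ne_of_mem_erase hj)]
  rw [h, map_smul, Pi.smul_apply, smul_eq_mul, ← Finset.mul_prod_erase _ _ (Finset.mem_univ i),
    Function.update_self, mul_comm]
  congr 1
  refine Finset.prod_congr rfl fun j hj => ?_
  rw [Function.update_of_ne (Finset.ne_of_mem_erase hj)]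

theorem q_prod (k : Fin d → ℕ) (F : Fin d → Circ → ℂ) :
    q k (fun x => ∏ j, F j (x j)) = fun x => ∏ j, eta (k j) (F j) (x j) := by
  -- Induction over the variables already treated; without repetitions, each factor is hit by its
  -- `eta` only once.
  have : ∀ L : List (Fin d), L.Nodup →
      (L.map fun j => onVar j (eta (k j))).prod (fun x => ∏ j, F j (x j)) =
        fun x => ∏ j, (if j ∈ L then eta (k j) (F j) else F j) (x j) := by
    intro L hL
    induction L with
    | nil => simp
    | cons a L ih =>
      rw [List.map_cons, List.prod_cons, Module.End.mul_apply, ih (List.nodup_cons.1 hL).2,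
        onVar_prod]
      funext x
      refine Finset.prod_congr rfl fun j _ => ?_
      by_cases hj : j = a
      · subst hj
        simp [(List.nodup_cons.1 hL).1]
      · simp [hj]
  rw [q, this _ (List.nodup_finRange d)]
  simp

theorem q_expo (k : Fin d → ℕ) (n : Fin d → ℤ) (x : Torus d) :
    q k (expo n) x = ∏ j, eta (k j) (fun s => fourier (n j) s) (x j) :=
  congrFun (q_prod k fun j s => fourier (n j) s) x

theorem norm_q_expo_le (k : Fin d → ℕ) (n : Fin d → ℤ) (x : Torus d) :
    ‖q k (expo n) x‖ ≤ 2 ^ d := by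
  rw [q_expo, norm_prod]
  refine (Finset.prod_le_prod (fun _ _ => norm_nonneg _)
    fun j _ => norm_eta_fourier_le (k j) (n j) (x j)).trans ?_
  simp

theorem q_expo_eq_zero {k l : Fin d → ℕ} {n : Fin d → ℤ} (hn : ∀ j, |n j| ≤ 2 ^ l j)
    (hk : ¬ k ≤ l) : q k (expo n) = 0 := by
  obtain ⟨j, hj⟩ := not_forall.1 hk
  funext x
  rw [q_expo]
  refine Finset.prod_eq_zero (Finset.mem_univ j) ?_
  rw [eta_fourier_eq_zero (not_le.1 hj) _ (hn j)]
  rfl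

/-- The index set is a box, so the sum factors into telescoping univariate sums. -/
theorem sum_q_expo {l : Fin d → ℕ} {n : Fin d → ℤ} (hn : ∀ j, |n j| ≤ 2 ^ l j) (x : Torus d) :
    ∑ k ∈ Finset.Iic l, q k (expo n) x = expo n x := by
  have : Finset.Iic l = Fintype.piFinset fun j => Finset.range (l j + 1) := by
    ext k
    simp [Pi.le_def]
  rw [this]
  simp only [q_expo]
  rw [← Finset.prod_univ_sum (fun j => Finset.range (l j + 1))
    fun j i => eta i (fun s => fourier (n j) s) (x j)]
  exact Finset.prod_congr rfl fun j _ => sum_eta_fourier (l j) (n j) (hn j) (x j)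

/-- The error of a sampling operator on an exponential is at most `2^d` times the number of the
missing terms. -/
theorem norm_expo_sub_samplingOp_le (Δ : Finset (Fin d → ℕ)) {l : Fin d → ℕ} {n : Fin d → ℤ}
    (hn : ∀ j, |n j| ≤ 2 ^ l j) (x : Torus d) :
    ‖expo n x - samplingOp Δ (expo n) x‖ ≤ 2 ^ d * (Finset.Iic l \ Δ).card := by
  have h1 : samplingOp Δ (expo n) x = ∑ k ∈ Finset.Iic l ∩ Δ, q k (expo n) x := by
    rw [samplingOp, LinearMap.sum_apply, Finset.sum_apply, Finset.inter_comm]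
    refine (Finset.sum_subset Finset.inter_subset_left fun k hk hk' => ?_).symm
    rw [q_expo_eq_zero hn fun h => hk' (Finset.mem_inter.2 ⟨hk, Finset.mem_Iic.2 h⟩)]
    rfl
  rw [h1, ← sum_q_expo hn x, ← Finset.sum_inter_add_sum_sdiff (Finset.Iic l) Δ,
    add_sub_cancel_left]
  refine (norm_sum_le _ _).trans ((Finset.sum_le_card_nsmul _ _ _
    fun k _ => norm_q_expo_le k n x).trans ?_)
  rw [nsmul_eq_mul, mul_comm]

end TensorProduct

/-! ### Multivariate Fourier series: density, orthogonality, Parseval -/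

section FourierSeries

variable {d : ℕ}

theorem continuous_expo (k : Fin d → ℤ) : Continuous (expo k) := by
  unfold expo
  fun_prop

/-- The exponential `expo k` as a bundled continuous map. -/
noncomputable def expoMap (k : Fin d → ℤ) : C(Torus d, ℂ) := ⟨expo k, continuous_expo k⟩

theorem expo_neg (k : Fin d → ℤ) (x : Torus d) : expo (-k) x = starRingEnd ℂ (expo k x) := by
  simp only [expo, Pi.neg_apply, fourier_neg, map_prod]

theorem expo_add (k l : Fin d → ℤ) (x : Torus d) : expo (k + l) x = expo k x * expo l x := by
  simp only [expo, Pi.add_apply, fourier_add, ← Finset.prod_mul_distrib]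

theorem norm_expo (k : Fin d → ℤ) (x : Torus d) : ‖expo k x‖ = 1 := by
  simp only [expo, norm_prod, norm_fourier_apply, Finset.prod_const_one]

theorem expo_single (z : Torus d) (i : Fin d) : expo (Pi.single i 1) z = fourier 1 (z i) := by
  rw [expo, Finset.prod_eq_single i]
  · rw [Pi.single_eq_same]
  · intro j _ hj
    rw [Pi.single_eq_of_ne hj, fourier_zero]
  · simp

/-- The star subalgebra of `C(Torus d, ℂ)` generated by the exponentials. -/
noncomputable def expoSubalgebra (d : ℕ) : StarSubalgebra ℂ C(Torus d, ℂ) where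
  toSubalgebra := Algebra.adjoin ℂ (Set.range expoMap)
  star_mem' := by
    change Algebra.adjoin ℂ (Set.range expoMap) ≤ star (Algebra.adjoin ℂ (Set.range expoMap))
    refine Algebra.adjoin_le ?_
    rintro _ ⟨n, rfl⟩
    refine Algebra.subset_adjoin ⟨-n, ?_⟩
    ext1 x
    exact expo_neg n x

/-- Exponentials are closed under multiplication, so Stone-Weierstrass for the algebra gives density
of the linear span. -/
theorem expoSubalgebra_coe :
    (expoSubalgebra d).toSubalgebra.toSubmodule = Submodule.span ℂ (Set.range expoMap) := by
  apply Algebra.adjoin_eq_span_of_subset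
  refine .trans (fun x => Submonoid.closure_induction (fun _ => id) ⟨0, ?_⟩ ?_)
    Submodule.subset_span
  · ext z
    change expo 0 z = 1
    simp [expo]
  · rintro _ _ _ _ ⟨m, rfl⟩ ⟨n, rfl⟩
    exact ⟨m + n, ContinuousMap.ext fun z => expo_add m n z⟩

theorem expoSubalgebra_separatesPoints : (expoSubalgebra d).SeparatesPoints := by
  intro x y hxy
  rw [Ne, funext_iff, not_forall] at hxy
  obtain ⟨i, hi⟩ := hxy
  refine ⟨_, ⟨expoMap (Pi.single i 1), Algebra.subset_adjoin ⟨Pi.single i 1, rfl⟩, rfl⟩, ?_⟩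
  change expo (Pi.single i 1) x ≠ expo (Pi.single i 1) y
  rw [expo_single, expo_single, fourier_one, fourier_one]
  exact fun h => hi (AddCircle.injective_toCircle Real.two_pi_pos.ne' (Circle.coe_injective h))

theorem span_expoMap_closure_eq_top :
    (Submodule.span ℂ (Set.range (expoMap (d := d)))).topologicalClosure = ⊤ := by
  rw [← expoSubalgebra_coe]
  exact congr_arg (Subalgebra.toSubmodule <| StarSubalgebra.toSubalgebra ·)
    (ContinuousMap.starSubalgebra_topologicalClosure_eq_top_of_separatesPoints _
      expoSubalgebra_separatesPoints)

/-- The exponential `expo k` as an element of `L₂`. -/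
noncomputable def expoLp (k : Fin d → ℤ) : Lp ℂ 2 (volume : Measure (Torus d)) :=
  ContinuousMap.toLp (E := ℂ) 2 volume ℂ (expoMap k)

theorem span_expoLp_closure_eq_top :
    (Submodule.span ℂ (Set.range (expoLp (d := d)))).topologicalClosure = ⊤ := by
  simpa only [Submodule.map_span, ContinuousLinearMap.coe_coe, ← Set.range_comp] using!
    (ContinuousMap.toLp_denseRange (p := 2) ℂ (volume : Measure (Torus d)) ℂ
      (by simp)).topologicalClosure_map_submodule span_expoMap_closure_eq_top

theorem integral_fourier (n : ℤ) :
    ∫ t : Circ, (fourier n t : ℂ) = if n = 0 then (2 * Real.pi : ℂ) else 0 := by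
  have h := congrFun (fourierCoeff_fourier (T := 2 * Real.pi) n) 0
  simp only [fourierCoeff, neg_zero, fourier_zero, one_smul] at h
  rw [AddCircle.integral_haarAddCircle] at h
  have hpi : (2 * Real.pi : ℂ) ≠ 0 := by exact_mod_cast Real.two_pi_pos.ne'
  split_ifs with hn
  · subst hn
    have : volume.real (Set.univ : Set Circ) = 2 * Real.pi := by
      rw [Measure.real, AddCircle.measure_univ, ENNReal.toReal_ofReal Real.two_pi_pos.le]
    simp [this]
  · rw [Pi.single_eq_of_ne (Ne.symm hn)] at h
    simpa [Real.pi_ne_zero] using h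

theorem integral_expo (k : Fin d → ℤ) :
    ∫ x : Torus d, expo k x = if k = 0 then ((2 * Real.pi) ^ d : ℂ) else 0 := by
  simp only [expo]
  rw [MeasureTheory.integral_fintype_prod_volume_eq_prod (fun j (t : Circ) => (fourier (k j) t : ℂ))]
  simp only [integral_fourier]
  split_ifs with h
  · simp [h]
  · obtain ⟨i, hi⟩ := Function.ne_iff.1 h
    exact Finset.prod_eq_zero (Finset.mem_univ i) (if_neg hi)

theorem inner_expoLp (f : Lp ℂ 2 (volume : Measure (Torus d))) (k : Fin d → ℤ) :
    inner ℂ (expoLp k) f = ((2 * Real.pi) ^ d : ℂ) * coeff f k := by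
  have hpi : (2 * Real.pi : ℂ) ≠ 0 := by exact_mod_cast Real.two_pi_pos.ne'
  rw [coeff]
  push_cast
  rw [mul_inv_cancel_left₀ (pow_ne_zero _ hpi), L2.inner_def]
  refine integral_congr_ae ?_
  filter_upwards [ContinuousMap.coeFn_toLp (p := 2) (𝕜 := ℂ) volume (expoMap k)] with x hx
  rw [expoLp, hx, RCLike.inner_apply, expo_neg]
  rfl

theorem inner_expoLp_expoLp (k l : Fin d → ℤ) :
    inner ℂ (expoLp k) (expoLp l) = if k = l then ((2 * Real.pi) ^ d : ℂ) else 0 := by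
  rw [expoLp, expoLp, ContinuousMap.inner_toLp]
  have : ∀ x : Torus d, expoMap l x * starRingEnd ℂ (expoMap k x) = expo (l + -k) x := by
    intro x
    rw [expo_add, expo_neg]
    rfl
  simp only [this, integral_expo, ← sub_eq_add_neg, sub_eq_zero, eq_comm (a := l)]

/-- An element of `L₂` with absolutely summable Fourier coefficients has a continuous
representative, which is the pointwise sum of the Fourier series. -/
theorem exists_continuous_of_summable (f : Lp ℂ 2 (volume : Measure (Torus d)))
    (hf : Summable fun k => ‖coeff f k‖) :
    ∃ g : C(Torus d, ℂ), ⇑g =ᵐ[volume] ⇑f ∧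
      HasSum (fun k => coeff f k • expo k) (g : Torus d → ℂ) := by
  have hs : Summable fun k => coeff f k • expoMap k := by
    refine Summable.of_norm_bounded hf fun k => ?_
    rw [norm_smul]
    refine mul_le_of_le_one_right (norm_nonneg _) ?_
    exact (ContinuousMap.norm_le _ zero_le_one).2 fun x => (norm_expo k x).le
  obtain ⟨g, hg⟩ := hs
  refine ⟨g, ?_, ?_⟩
  · have hL : HasSum (fun k => coeff f k • expoLp k)
        (ContinuousMap.toLp (E := ℂ) 2 volume ℂ g) := by
      simpa [expoLp, Function.comp_def] using
        hg.mapL (ContinuousMap.toLp (E := ℂ) 2 (volume : Measure (Torus d)) ℂ)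
    -- The difference is orthogonal to every exponential, hence to a dense subspace.
    have h0 : ContinuousMap.toLp (E := ℂ) 2 volume ℂ g - f = 0 := by
      have hD := Submodule.dense_iff_topologicalClosure_eq_top.2 (span_expoLp_closure_eq_top (d := d))
      refine hD.eq_zero_of_inner_right (𝕜 := ℂ) fun v hv => ?_
      induction hv using Submodule.span_induction with
      | mem v hv =>
        obtain ⟨k, rfl⟩ := hv
        rw [inner_sub_right, inner_expoLp (f := f), sub_eq_zero]
        refine ((hL.mapL (innerSL ℂ (expoLp k))).unique ?_)
        have := hasSum_ite_eq k (((2 * Real.pi) ^ d : ℂ) * coeff f k)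
        refine this.congr_fun fun l => ?_
        simp only [innerSL_apply_apply, inner_smul_right, inner_expoLp_expoLp, eq_comm (a := l)]
        split_ifs with h
        · rw [h, mul_comm]
        · simp
      | zero => exact inner_zero_left _
      | add u v _ _ hu hv => rw [inner_add_left, hu, hv, add_zero]
      | smul c u _ hu => rw [inner_smul_left, hu, mul_zero]
    rw [← sub_eq_zero.1 h0]
    exact (ContinuousMap.coeFn_toLp (p := 2) (𝕜 := ℂ) volume g).symm
  · rw [Pi.hasSum]
    intro x
    exact hg.mapL (ContinuousMap.evalCLM ℂ x)

/-- Parseval's identity for a block of the Fourier series. -/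
theorem eLpNorm_blockPart_sq (f : Torus d → ℂ) (l : Fin d → ℕ) :
    eLpNorm (blockPart f l) 2 volume ^ 2 = ENNReal.ofReal ((2 * Real.pi) ^ d) *
      ∑ k ∈ Fintype.piFinset fun j => dyadicBlock (l j), ‖coeff f k‖ₑ ^ 2 := by
  set S := Fintype.piFinset fun j => dyadicBlock (l j)
  set F : Lp ℂ 2 (volume : Measure (Torus d)) := ∑ k ∈ S, coeff f k • expoLp k with hF
  have h1 : eLpNorm (blockPart f l) 2 volume = ‖F‖ₑ := by
    have : F = ContinuousMap.toLp (E := ℂ) 2 volume ℂ (∑ k ∈ S, coeff f k • expoMap k) := by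
      simp [hF, expoLp]
    rw [this, Lp.enorm_def]
    refine eLpNorm_congr_ae ?_
    filter_upwards [ContinuousMap.coeFn_toLp (p := 2) (𝕜 := ℂ) volume
      (∑ k ∈ S, coeff f k • expoMap k)] with x hx
    rw [hx]
    simp [blockPart, expoMap, S]
  have h2 : ‖F‖ ^ 2 = (2 * Real.pi) ^ d * ∑ k ∈ S, ‖coeff f k‖ ^ 2 := by
    have : ((‖F‖ ^ 2 : ℝ) : ℂ) = (((2 * Real.pi) ^ d * ∑ k ∈ S, ‖coeff f k‖ ^ 2 : ℝ) : ℂ) := by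
      have h := inner_self_eq_norm_sq_to_K (𝕜 := ℂ) F
      push_cast
      refine h.symm.trans ?_
      nth_rewrite 1 [hF]
      rw [sum_inner, Finset.mul_sum]
      refine Finset.sum_congr rfl fun k hk => ?_
      rw [hF, inner_sum]
      simp only [inner_smul_left, inner_smul_right, inner_expoLp_expoLp]
      simp only [mul_ite, mul_zero, Finset.sum_ite_eq, hk, if_true]
      rw [← Complex.conj_mul']
      ring
    exact_mod_cast this
  rw [h1, ← ofReal_norm, ← ENNReal.ofReal_pow (norm_nonneg _), h2,
    ENNReal.ofReal_mul (by positivity), ENNReal.ofReal_sum_of_nonneg (fun _ _ => by positivity)]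
  simp only [ENNReal.ofReal_pow (norm_nonneg _), ofReal_norm]

end FourierSeries

/-! ### Dyadic blocks of frequencies -/

section Blocks

/-- The block index is the binary length of `|n|`, with length 0 for `n = 0`; hence the blocks
partition the integers. -/
theorem mem_dyadicBlock (n : ℤ) (j : ℕ) : n ∈ dyadicBlock j ↔ n.natAbs.size = j := by
  cases j with
  | zero => simp [dyadicBlock, Nat.size_eq_zero]
  | succ j =>
    have h1 : n.natAbs.size = j + 1 ↔ 2 ^ j ≤ n.natAbs ∧ n.natAbs < 2 ^ (j + 1) := by
      rw [← Nat.size_le, ← Nat.lt_size]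
      omega
    have h2 : ((2 : ℤ) ^ j ≤ |n| ∧ |n| < 2 ^ (j + 1)) ↔
        2 ^ j ≤ n.natAbs ∧ n.natAbs < 2 ^ (j + 1) := by
      rw [Int.abs_eq_natAbs]
      norm_cast
    rw [h1, ← h2, dyadicBlock, Finset.mem_filter, Finset.mem_Icc, and_iff_right_iff_imp]
    exact fun h => ⟨(abs_le.1 h.2.le).1, (abs_le.1 h.2.le).2⟩

theorem card_dyadicBlock_le (j : ℕ) : (dyadicBlock j).card ≤ 2 ^ j := by
  cases j with
  | zero => simp [dyadicBlock]
  | succ j =>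
    have : dyadicBlock (j + 1) ⊆
        Finset.Ico ((2 : ℤ) ^ j) (2 ^ (j + 1)) ∪ Finset.Ioc (-2 ^ (j + 1)) (-(2 : ℤ) ^ j) := by
      intro n hn
      simp only [dyadicBlock, Finset.mem_filter] at hn
      simp only [Finset.mem_union, Finset.mem_Ico, Finset.mem_Ioc]
      obtain ⟨-, h1, h2⟩ := hn
      rw [abs_lt] at h2
      rcases le_abs.1 h1 with h | h
      · exact Or.inl ⟨h, h2.2⟩
      · exact Or.inr ⟨h2.1, by linarith⟩
    refine (Finset.card_le_card this).trans ((Finset.card_union_le _ _).trans ?_)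
    rw [Int.card_Ico, Int.card_Ioc]
    have : (2 : ℤ) ^ (j + 1) - 2 ^ j = ((2 ^ j : ℕ) : ℤ) := by push_cast; ring
    rw [this, show -(2 : ℤ) ^ j - -2 ^ (j + 1) = (2 : ℤ) ^ (j + 1) - 2 ^ j by ring, this,
      Int.toNat_natCast, pow_succ]
    omega

variable {d : ℕ}

/-- The index of the dyadic block that contains a frequency. -/
def blockIndex (n : Fin d → ℤ) : Fin d → ℕ := fun j => (n j).natAbs.size

theorem mem_piFinset_dyadicBlock (n : Fin d → ℤ) (l : Fin d → ℕ) :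
    n ∈ (Fintype.piFinset fun j => dyadicBlock (l j)) ↔ blockIndex n = l := by
  simp only [Fintype.mem_piFinset, mem_dyadicBlock, blockIndex, funext_iff]

theorem abs_le_two_pow_blockIndex (n : Fin d → ℤ) (j : Fin d) : |n j| ≤ 2 ^ blockIndex n j := by
  rw [Int.abs_eq_natAbs]
  exact_mod_cast (Nat.lt_size_self (n j).natAbs).le

theorem card_piFinset_dyadicBlock_le (l : Fin d → ℕ) :
    (Fintype.piFinset fun j => dyadicBlock (l j)).card ≤ 2 ^ ∑ j, l j := by
  rw [Fintype.card_piFinset, ← Finset.prod_pow_eq_pow_sum]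
  exact Finset.prod_le_prod' fun j _ => card_dyadicBlock_le (l j)

theorem tsum_eq_tsum_block (F : (Fin d → ℤ) → ℝ≥0∞) :
    ∑' n, F n = ∑' l : Fin d → ℕ, ∑ n ∈ Fintype.piFinset fun j => dyadicBlock (l j), F n := by
  have h1 : ∀ n, F n = ∑' l : Fin d → ℕ, if blockIndex n = l then F n else 0 := by
    intro n
    rw [tsum_eq_single (blockIndex n) fun l hl => if_neg (Ne.symm hl), if_pos rfl]
  rw [tsum_congr h1, ENNReal.tsum_comm]
  refine tsum_congr fun l => ?_
  simp only [← mem_piFinset_dyadicBlock]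
  rw [tsum_eq_sum fun n hn => if_neg hn]
  exact Finset.sum_congr rfl fun n hn => if_pos hn

end Blocks

/-! ### Weighted sums of coefficients against the mixed norm -/

section CauchySchwarz

theorem tsum_mul_le_sqrt_mul_sqrt {ι : Type*} (f g : ι → ℝ≥0∞) :
    ∑' i, f i * g i ≤ (∑' i, f i ^ 2) ^ (1 / 2 : ℝ) * (∑' i, g i ^ 2) ^ (1 / 2 : ℝ) := by
  rw [ENNReal.tsum_eq_iSup_sum]
  refine iSup_le fun s => ?_
  refine (ENNReal.inner_le_Lp_mul_Lq s f g Real.HolderConjugate.two_two).trans ?_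
  simp only [ENNReal.rpow_two]
  gcongr <;> exact ENNReal.sum_le_tsum s

theorem sum_le_card_mul_sqrt {ι : Type*} (s : Finset ι) (f : ι → ℝ≥0∞) :
    ∑ i ∈ s, f i ≤ (s.card : ℝ≥0∞) ^ (1 / 2 : ℝ) * (∑ i ∈ s, f i ^ 2) ^ (1 / 2 : ℝ) := by
  have := ENNReal.inner_le_Lp_mul_Lq s 1 f Real.HolderConjugate.two_two
  simpa [ENNReal.rpow_two] using this

theorem sq_rpow_half (a : ℝ≥0∞) : (a ^ 2) ^ (1 / 2 : ℝ) = a := by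
  rw [← ENNReal.rpow_two, ← ENNReal.rpow_mul]
  norm_num

theorem rpow_half_sq (a : ℝ≥0∞) : (a ^ (1 / 2 : ℝ)) ^ 2 = a := by
  rw [← ENNReal.rpow_two, ← ENNReal.rpow_mul]
  norm_num

variable {d : ℕ}

theorem sum_block_coeff_le (f : Torus d → ℂ) (l : Fin d → ℕ) :
    ∑ k ∈ Fintype.piFinset fun j => dyadicBlock (l j), ‖coeff f k‖ₑ ≤
      (2 ^ ∑ j, l j) ^ (1 / 2 : ℝ) * eLpNorm (blockPart f l) 2 volume := by
  refine (sum_le_card_mul_sqrt _ _).trans ?_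
  rw [← sq_rpow_half (eLpNorm (blockPart f l) 2 volume), eLpNorm_blockPart_sq]
  gcongr
  · exact_mod_cast card_piFinset_dyadicBlock_le l
  -- Parseval carries the factor `(2π)^d ≥ 1`, which may be dropped.
  · refine le_mul_of_one_le_left' ?_
    rw [ENNReal.one_le_ofReal]
    exact one_le_pow₀ (by linarith [Real.pi_gt_three])

/-- Weighted `ℓ¹`-sums of the Fourier coefficients are bounded by the norm of mixed smoothness. -/
theorem tsum_coeff_mul_le (α : ℝ) (f : Torus d → ℂ) (w : (Fin d → ℕ) → ℝ≥0∞) :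
    ∑' n, ‖coeff f n‖ₑ * w (blockIndex n) ≤
      (∑' l, w l ^ 2 * ENNReal.ofReal ((2 : ℝ) ^ (1 - 2 * α)) ^ ∑ j, l j) ^ (1 / 2 : ℝ) *
        hmixNorm α f := by
  set r := ENNReal.ofReal ((2 : ℝ) ^ (1 - 2 * α))
  set a := ENNReal.ofReal ((2 : ℝ) ^ (2 * α))
  -- Splits the block-size factor `2^{|l|₁}`: `a` supplies the weight of the norm, `r` stays with
  -- `w`.
  have har : (2 : ℝ≥0∞) = r * a := by
    rw [← ENNReal.ofReal_mul (by positivity), ← Real.rpow_add two_pos]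
    norm_num
  have ha : ∀ l : Fin d → ℕ,
      ENNReal.ofReal ((2 : ℝ) ^ (2 * α * ((∑ j, l j : ℕ) : ℝ))) = a ^ ∑ j, l j := by
    intro l
    rw [← ENNReal.ofReal_pow (by positivity), Real.rpow_mul two_pos.le, Real.rpow_natCast]
  rw [tsum_eq_tsum_block, hmixNorm]
  calc _ ≤ ∑' l : Fin d → ℕ, (w l * (r ^ ∑ j, l j) ^ (1 / 2 : ℝ)) *
        ((a ^ ∑ j, l j) ^ (1 / 2 : ℝ) * eLpNorm (blockPart f l) 2 volume) := by
        refine ENNReal.tsum_le_tsum fun l => ?_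
        have : ∑ n ∈ Fintype.piFinset fun j => dyadicBlock (l j),
            ‖coeff f n‖ₑ * w (blockIndex n) =
            (∑ n ∈ Fintype.piFinset fun j => dyadicBlock (l j), ‖coeff f n‖ₑ) * w l := by
          rw [Finset.sum_mul]
          refine Finset.sum_congr rfl fun n hn => ?_
          rw [(mem_piFinset_dyadicBlock n l).1 hn]
        rw [this]
        refine (mul_le_mul_left (sum_block_coeff_le f l) (w l)).trans (le_of_eq ?_)
        rw [har, mul_pow, ENNReal.mul_rpow_of_nonneg _ _ (by norm_num)]
        ring
    _ ≤ _ := by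
        refine (tsum_mul_le_sqrt_mul_sqrt _ _).trans (le_of_eq ?_)
        simp only [mul_pow, rpow_half_sq, ha]

end CauchySchwarz

/-! ### Counting indices and the tail sum -/

section Counting

theorem tsum_length_le (d : ℕ) (F : ℕ → ℝ≥0∞) :
    ∑' l : Fin (d + 1) → ℕ, F (∑ j, l j) ≤ ∑' s : ℕ, ((s : ℝ≥0∞) + 1) ^ d * F s := by
  have h1 : ∀ l : Fin (d + 1) → ℕ,
      F (∑ j, l j) = ∑' s : ℕ, if ∑ j, l j = s then F s else 0 := by
    intro l
    rw [tsum_eq_single (∑ j, l j) fun s hs => if_neg (Ne.symm hs), if_pos rfl]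
  rw [tsum_congr h1, ENNReal.tsum_comm]
  refine ENNReal.tsum_le_tsum fun s => ?_
  have hmem : ∀ l : Fin (d + 1) → ℕ,
      ∑ j, l j = s ↔ l ∈ Finset.piAntidiag (Finset.univ : Finset (Fin (d + 1))) s := by
    intro l
    simp [Finset.mem_piAntidiag]
  simp only [hmem]
  rw [tsum_eq_sum fun n hn => if_neg hn, Finset.sum_congr rfl fun n hn => if_pos hn,
    Finset.sum_const, nsmul_eq_mul]
  gcongr
  have : (Finset.piAntidiag (Finset.univ : Finset (Fin (d + 1))) s).card ≤
      (Fintype.piFinset fun _ : Fin d => Finset.range (s + 1)).card := by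
    -- The last coordinate is determined by the others and the total `s`.
    refine Finset.card_le_card_of_injOn (fun l j => l j.castSucc) ?_ ?_
    · intro l hl
      have hl := (hmem l).2 hl
      simp only [Finset.mem_coe, Fintype.mem_piFinset, Finset.mem_range, Nat.lt_succ_iff, ← hl]
      exact fun j => Finset.single_le_sum (fun _ _ => Nat.zero_le _) (Finset.mem_univ _)
    · intro l hl l' hl' h
      have hl := (hmem l).2 hl
      have hl' := (hmem l').2 hl'
      rw [Fin.sum_univ_castSucc] at hl hl'
      have h2 : ∑ j : Fin d, l j.castSucc = ∑ j : Fin d, l' j.castSucc :=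
        Finset.sum_congr rfl fun j _ => congrFun h j
      funext i
      refine Fin.lastCases ?_ (fun j => congrFun h j) i
      omega
  simp only [Fintype.card_piFinset, Finset.card_range, Finset.prod_const, Finset.card_univ,
    Fintype.card_fin] at this
  exact_mod_cast this

theorem card_Iic_sdiff_smolyakIndex_le {d : ℕ} {α : ℝ} (hα : 0 < α) (m : ℕ) (l : Fin d → ℕ) :
    (Finset.Iic l \ smolyakIndex d α (α * m)).card ≤ (∑ j, l j - m) ^ d := by
  have : (Finset.Iic l \ smolyakIndex d α (α * m)).card ≤
      (Fintype.piFinset fun _ : Fin d => Finset.range (∑ j, l j - m)).card := by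
    -- For `k ≤ l` with `|k|₁ > m`, every coordinate of `l - k` is at most `|l|₁ - |k|₁ < |l|₁ - m`.
    refine Finset.card_le_card_of_injOn (fun k j => l j - k j) ?_ ?_
    · intro k hk
      simp only [Finset.coe_sdiff, Set.mem_sdiff, Finset.mem_coe, Finset.mem_Iic,
        mem_smolyakIndex_mul hα, not_le] at hk
      simp only [Finset.mem_coe, Fintype.mem_piFinset, Finset.mem_range]
      intro j
      have h1 : l j - k j ≤ ∑ i, (l i - k i) :=
        Finset.single_le_sum (f := fun i => l i - k i) (fun _ _ => Nat.zero_le _)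
          (Finset.mem_univ j)
      have h2 : ∑ i, (l i - k i) + ∑ i, k i = ∑ i, l i := by
        rw [← Finset.sum_add_distrib]
        exact Finset.sum_congr rfl fun i _ => Nat.sub_add_cancel (hk.1 i)
      omega
    · intro k hk k' hk' h
      simp only [Finset.coe_sdiff, Set.mem_sdiff, Finset.mem_coe, Finset.mem_Iic] at hk hk'
      funext j
      have h1 := congrFun h j
      have h2 : k j ≤ l j := hk.1 j
      have h3 : k' j ≤ l j := hk'.1 j
      simp only at h1
      omega
  simpa using this

theorem tsum_pow_mul_geometric_ne_top {r : ℝ} (h0 : 0 < r) (h1 : r < 1) (k : ℕ) :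
    ∑' t : ℕ, ((t : ℝ≥0∞) + 2) ^ k * ENNReal.ofReal r ^ t ≠ ⊤ := by
  have hs : Summable fun t : ℕ => ((t : ℝ) + 2) ^ k * r ^ t := by
    have := (summable_nat_add_iff 2).2 (summable_pow_mul_geometric_of_norm_lt_one k
      (r := r) (by rwa [Real.norm_of_nonneg h0.le]))
    refine (this.mul_right (r ^ 2)⁻¹).congr fun t => ?_
    push_cast
    rw [pow_add]
    field_simp
  have := hs.tsum_ofReal_ne_top
  convert this using 3 with t
  rw [ENNReal.ofReal_mul (by positivity), ENNReal.ofReal_pow h0.le,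
    ENNReal.ofReal_pow (by positivity), ENNReal.ofReal_add (by positivity) two_pos.le]
  simp

/-- The tail estimate behind the rate `2^{-m(α - 1/2)} m^{(d-1)/2}`. -/
theorem tsum_tail_le (d : ℕ) (r : ℝ≥0∞) {m : ℕ} (hm : 1 ≤ m) :
    ∑' l : Fin (d + 1) → ℕ, ((((∑ j, l j - m) ^ (d + 1) : ℕ) : ℝ≥0∞) ^ 2 * r ^ ∑ j, l j) ≤
      (m : ℝ≥0∞) ^ d * r ^ m * ∑' t : ℕ, ((t : ℝ≥0∞) + 2) ^ (d + 2 * (d + 1)) * r ^ t := by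
  refine (tsum_length_le d fun s => (((s - m) ^ (d + 1) : ℕ) : ℝ≥0∞) ^ 2 * r ^ s).trans ?_
  rw [← ENNReal.tsum_mul_left]
  -- Reindexing by `s = t + m` is lossless: for `s < m` the truncated difference `s - m` is 0 and
  -- its exponent is positive.
  rw [← (Function.Injective.tsum_eq (add_left_injective m) (f := fun s : ℕ =>
    ((s : ℝ≥0∞) + 1) ^ d * ((((s - m) ^ (d + 1) : ℕ) : ℝ≥0∞) ^ 2 * r ^ s)) ?_)]
  · refine ENNReal.tsum_le_tsum fun t => ?_
    have h1 : (((t + m : ℕ) : ℝ≥0∞) + 1) ^ d ≤ (m : ℝ≥0∞) ^ d * ((t : ℝ≥0∞) + 2) ^ d := by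
      rw [← mul_pow]
      gcongr
      -- The difference of the two sides is `(m - 1)(t + 1)`.
      have : t + m + 1 ≤ m * (t + 2) := by
        obtain ⟨m, rfl⟩ := Nat.exists_eq_add_of_le' hm
        nlinarith [Nat.zero_le (m * t)]
      exact_mod_cast this
    have h2 : (((t + m - m) ^ (d + 1) : ℕ) : ℝ≥0∞) ^ 2 ≤ ((t : ℝ≥0∞) + 2) ^ (2 * (d + 1)) := by
      rw [Nat.add_sub_cancel, Nat.cast_pow, ← pow_mul, mul_comm (d + 1)]
      gcongr
      exact le_self_add
    refine (mul_le_mul' h1 (mul_le_mul' h2 le_rfl)).trans (le_of_eq ?_)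
    ring
  · intro s hs
    refine ⟨s - m, Nat.sub_add_cancel ?_⟩
    by_contra h
    refine hs ?_
    simp [Nat.sub_eq_zero_of_le (not_le.1 h).le]

end Counting

/-! ### Finiteness of the norm, absolute summability and the error bound -/

section Main

theorem two_rpow_le_of_mem_dyadicBlock {α : ℝ} (hα : 0 ≤ α) {n : ℤ} {j : ℕ}
    (h : n ∈ dyadicBlock j) :
    (2 : ℝ) ^ (2 * α * j) ≤ 4 ^ α * (1 + (n : ℝ) ^ 2) ^ α := by
  -- The constant 4 compensates for `|n| ≥ 2^{j-1}` rather than `2^j`.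
  have h1 : (4 : ℝ) ^ j ≤ 4 * (1 + (n : ℝ) ^ 2) := by
    cases j with
    | zero => nlinarith [sq_nonneg (n : ℝ)]
    | succ j =>
      simp only [dyadicBlock, Finset.mem_filter] at h
      have h2 : (2 : ℝ) ^ j ≤ |(n : ℝ)| := by exact_mod_cast h.2.1
      have h3 : ((2 : ℝ) ^ j) ^ 2 ≤ |(n : ℝ)| ^ 2 := by gcongr
      rw [sq_abs, ← pow_mul, mul_comm, pow_mul] at h3
      norm_num at h3
      rw [pow_succ]
      linarith
  rw [← Real.mul_rpow (by norm_num) (by positivity)]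
  calc (2 : ℝ) ^ (2 * α * j) = ((4 : ℝ) ^ j) ^ α := by
        rw [show (4 : ℝ) = 2 ^ (2 : ℝ) by norm_num, ← Real.rpow_mul_natCast two_pos.le,
          ← Real.rpow_mul two_pos.le]
        ring_nf
    _ ≤ _ := Real.rpow_le_rpow (by positivity) h1 hα

variable {d : ℕ} {α : ℝ}

theorem hmixNorm_ne_top (hα : 0 ≤ α) {f : Lp ℂ 2 (volume : Measure (Torus d))}
    (hf : MemHmix α f) : hmixNorm α f ≠ ⊤ := by
  refine ENNReal.rpow_ne_top_of_nonneg (by norm_num) ?_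
  have hs : ∑' n : Fin d → ℤ, ENNReal.ofReal ((2 * Real.pi) ^ d * (4 ^ α) ^ d *
      (‖coeff f n‖ ^ 2 * ∏ j, (1 + (n j : ℝ) ^ 2) ^ α)) ≠ ⊤ :=
    (hf.mul_left _).tsum_ofReal_ne_top
  refine ne_top_of_le_ne_top hs ?_
  rw [tsum_eq_tsum_block]
  refine ENNReal.tsum_le_tsum fun l => ?_
  rw [eLpNorm_blockPart_sq, Finset.mul_sum, Finset.mul_sum]
  refine Finset.sum_le_sum fun n hn => ?_
  rw [← ofReal_norm, ← ENNReal.ofReal_pow (norm_nonneg _),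
    ← ENNReal.ofReal_mul (by positivity), ← ENNReal.ofReal_mul (by positivity)]
  refine ENNReal.ofReal_le_ofReal ?_
  have h : (2 : ℝ) ^ (2 * α * ((∑ j, l j : ℕ) : ℝ)) ≤
      (4 ^ α) ^ d * ∏ j, (1 + (n j : ℝ) ^ 2) ^ α := by
    rw [Nat.cast_sum, Finset.mul_sum, Real.rpow_sum_of_pos two_pos]
    refine (Finset.prod_le_prod (fun _ _ => by positivity) fun j _ =>
      two_rpow_le_of_mem_dyadicBlock hα (Fintype.mem_piFinset.1 hn j)).trans (le_of_eq ?_)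
    rw [Finset.prod_mul_distrib]
    simp
  calc _ ≤ (4 ^ α) ^ d * (∏ j, (1 + (n j : ℝ) ^ 2) ^ α) * ((2 * Real.pi) ^ d * ‖coeff f n‖ ^ 2) := by
        gcongr
    _ = _ := by ring

/-- Functions of mixed smoothness `α > 1/2` have absolutely summable Fourier coefficients. -/
theorem MemHmix.summable_coeff (hα : 1 / 2 < α) {f : Lp ℂ 2 (volume : Measure (Torus (d + 1)))}
    (hf : MemHmix α f) : Summable fun n => ‖coeff f n‖ := by
  have h0 : (0 : ℝ) < 2 ^ (1 - 2 * α) := by positivity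
  have h1 : (2 : ℝ) ^ (1 - 2 * α) < 1 := Real.rpow_lt_one_of_one_lt_of_neg one_lt_two (by linarith)
  have h := tsum_coeff_mul_le α f fun _ => 1
  simp only [mul_one, one_pow, one_mul] at h
  have hfin : ∑' l : Fin (d + 1) → ℕ, ENNReal.ofReal ((2 : ℝ) ^ (1 - 2 * α)) ^ ∑ j, l j ≠ ⊤ := by
    refine ne_top_of_le_ne_top (tsum_pow_mul_geometric_ne_top h0 h1 d) ?_
    refine (tsum_length_le d fun s => ENNReal.ofReal ((2 : ℝ) ^ (1 - 2 * α)) ^ s).trans ?_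
    refine ENNReal.tsum_le_tsum fun s => ?_
    gcongr
    exact one_le_two
  have := ne_top_of_le_ne_top (ENNReal.mul_ne_top
    (ENNReal.rpow_ne_top_of_nonneg (by norm_num) hfin) (hmixNorm_ne_top (by linarith) hf)) h
  exact summable_norm_iff.2 (Summable.of_enorm this)

/-- Pointwise error of a sampling operator on an absolutely convergent Fourier series. -/
theorem enorm_sub_samplingOp_le {c : (Fin d → ℤ) → ℂ} {g : Torus d → ℂ}
    (hg : HasSum (fun n => c n • expo n) g) (Δ : Finset (Fin d → ℕ)) (x : Torus d) :
    ‖(g - samplingOp Δ g) x‖ₑ ≤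
      2 ^ d * ∑' n, ‖c n‖ₑ * ((Finset.Iic (blockIndex n) \ Δ).card : ℝ≥0∞) := by
  have h : HasSum (fun n => c n * (expo n x - samplingOp Δ (expo n) x)) ((g - samplingOp Δ g) x) := by
    have h1 := hg.sub (hg.map (samplingOp Δ) (continuous_samplingOp Δ))
    refine (Pi.hasSum.1 h1 x).congr_fun fun n => ?_
    simp [mul_sub]
  rw [← h.tsum_eq]
  refine enorm_tsum_le_tsum_enorm.trans ?_
  rw [← ENNReal.tsum_mul_left]
  refine ENNReal.tsum_le_tsum fun n => ?_
  rw [enorm_mul, mul_left_comm]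
  gcongr
  rw [← ofReal_norm]
  refine (ENNReal.ofReal_le_ofReal
    (norm_expo_sub_samplingOp_le Δ (abs_le_two_pow_blockIndex n) x)).trans (le_of_eq ?_)
  rw [ENNReal.ofReal_mul (by positivity), ENNReal.ofReal_pow two_pos.le, ENNReal.ofReal_natCast]
  simp

end Main

end SmolyakTrig

theorem theorem5 (d : ℕ) (hd : 1 ≤ d) (α : ℝ) (hα : 1 / 2 < α) :
    ∃ C : ℝ, 0 < C ∧
      ∀ f : Lp ℂ 2 (volume : Measure (SmolyakTrig.Torus d)), SmolyakTrig.MemHmix α f →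
        (∃ g : C(SmolyakTrig.Torus d, ℂ), ⇑g =ᵐ[volume] ⇑f) ∧
        ∀ g : C(SmolyakTrig.Torus d, ℂ), ⇑g =ᵐ[volume] ⇑f → ∀ m : ℕ, 1 ≤ m →
          eLpNorm
              (⇑g - SmolyakTrig.samplingOp (SmolyakTrig.smolyakIndex d α (α * (m : ℝ))) ⇑g)
              ⊤ volume ≤
            ENNReal.ofReal (C * (2 : ℝ) ^ (-((m : ℝ) * (α - 1 / 2))) *
              (m : ℝ) ^ (((d : ℝ) - 1) / 2)) * SmolyakTrig.hmixNorm α ⇑f := by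
  open SmolyakTrig in
  obtain ⟨d, rfl⟩ := Nat.exists_eq_add_of_le' hd
  have h0 : (0 : ℝ) < 2 ^ (1 - 2 * α) := by positivity
  have h1 : (2 : ℝ) ^ (1 - 2 * α) < 1 := Real.rpow_lt_one_of_one_lt_of_neg one_lt_two (by linarith)
  set r := ENNReal.ofReal ((2 : ℝ) ^ (1 - 2 * α)) with hr
  set K := ∑' t : ℕ, ((t : ℝ≥0∞) + 2) ^ (d + 2 * (d + 1)) * r ^ t with hK
  have hKtop : K ≠ ⊤ := tsum_pow_mul_geometric_ne_top h0 h1 _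
  -- The summand 1 only secures positivity of the constant.
  refine ⟨2 ^ (d + 1) * K.toReal ^ (1 / 2 : ℝ) + 1, by positivity, fun f hf => ?_⟩
  obtain ⟨g₀, hg₀, hsum⟩ := exists_continuous_of_summable f (hf.summable_coeff hα)
  refine ⟨⟨g₀, hg₀⟩, fun g hg m hm => ?_⟩
  -- Nonempty open sets have positive measure, so the continuous representative is unique and equals
  -- the Fourier sum everywhere.
  have hgg : (g : Torus (d + 1) → ℂ) = g₀ :=
    (Continuous.ae_eq_iff_eq volume g.continuous g₀.continuous).1 (hg.trans hg₀.symm)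
  rw [hgg, eLpNorm_exponent_top]
  refine essSup_le_of_ae_le _ (Filter.Eventually.of_forall fun x => ?_)
  refine (enorm_sub_samplingOp_le hsum _ x).trans ?_
  have hconst : (2 : ℝ≥0∞) ^ (d + 1) * ((m : ℝ≥0∞) ^ d * r ^ m * K) ^ (1 / 2 : ℝ) ≤
      ENNReal.ofReal ((2 ^ (d + 1) * K.toReal ^ (1 / 2 : ℝ) + 1) *
        (2 : ℝ) ^ (-((m : ℝ) * (α - 1 / 2))) * (m : ℝ) ^ ((((d + 1 : ℕ) : ℝ) - 1) / 2)) := by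
    have e1 : ((m : ℝ) ^ d) ^ (1 / 2 : ℝ) = (m : ℝ) ^ ((((d + 1 : ℕ) : ℝ) - 1) / 2) := by
      rw [← Real.rpow_natCast, ← Real.rpow_mul (Nat.cast_nonneg m)]
      push_cast
      ring_nf
    have e2 : (((2 : ℝ) ^ (1 - 2 * α)) ^ m) ^ (1 / 2 : ℝ) = 2 ^ (-((m : ℝ) * (α - 1 / 2))) := by
      rw [← Real.rpow_mul_natCast two_pos.le, ← Real.rpow_mul two_pos.le]
      ring_nf
    have e3 : (2 : ℝ≥0∞) ^ (d + 1) * ((m : ℝ≥0∞) ^ d * r ^ m * K) ^ (1 / 2 : ℝ) =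
        ENNReal.ofReal (2 ^ (d + 1) *
          ((m : ℝ) ^ d * ((2 : ℝ) ^ (1 - 2 * α)) ^ m * K.toReal) ^ (1 / 2 : ℝ)) := by
      rw [ENNReal.ofReal_mul (by positivity), ← ENNReal.ofReal_rpow_of_nonneg (by positivity)
        (by norm_num), ENNReal.ofReal_mul (by positivity), ENNReal.ofReal_mul (by positivity),
        ENNReal.ofReal_toReal hKtop, ENNReal.ofReal_pow h0.le, ENNReal.ofReal_pow (by positivity),
        ENNReal.ofReal_pow (by positivity), ENNReal.ofReal_natCast, ← hr]
      simp
    rw [e3]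
    refine ENNReal.ofReal_le_ofReal ?_
    rw [Real.mul_rpow (by positivity) (by positivity), Real.mul_rpow (by positivity) (by positivity),
      e1, e2]
    have : 0 ≤ (2 : ℝ) ^ (-((m : ℝ) * (α - 1 / 2))) * (m : ℝ) ^ ((((d + 1 : ℕ) : ℝ) - 1) / 2) := by
      positivity
    nlinarith
  refine le_trans ?_ (mul_le_mul_left hconst _)
  rw [mul_assoc]
  gcongr
  refine (tsum_coeff_mul_le α f fun l =>
    ((Finset.Iic l \ smolyakIndex (d + 1) α (α * m)).card : ℝ≥0∞)).trans ?_
  gcongr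
  refine le_trans (ENNReal.tsum_le_tsum fun l => ?_) (tsum_tail_le d r hm)
  gcongr
  exact card_Iic_sdiff_smolyakIndex_le (by linarith) m l
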